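/- Let $n$ be a natural number and let $\mathbb{S}^n$ be the space of real symmetric $n\times n$ matrices with the inner product $\langle X,Y\rangle=\operatorname{tr}(XY)$ and the induced (Frobenius) norm $\|\cdot\|$. Let $\mathbb{S}^n_+$ be the cone of positive semidefinite matrices and $\mathbb{S}^n_{++}$ its interior, the positive definite matrices. For $f:\mathbb{S}^n\to(-\infty,\infty]$ put $\operatorname{dom} f=\{X: f(X)<\infty\}$, and let $\delta$ be the indicator function of $\mathbb{S}^n_+$ ($0$ on $\mathbb{S}^n_+$, $\infty$ elsewhere). Let $0<\gamma_{\min}\le\gamma_{\max}$, $\gamma_{1,k},\gamma_{2,k}\in[\gamma_{\min},\gamma_{\max}]$ for $k\ge0$, and $r>1$. Assume that * $f$ is continuously differentiable on $\operatorname{int}\operatorname{dom} f$, bounded from below on $\mathbb{S}^n_+$, and lower semicontinuous; * $\mathbb{S}^n_{++}\subset\operatorname{int}\operatorname{dom} f$ and $\operatorname{dom} f\cap\mathbb{S}^n_+\subset\operatorname{int}\operatorname{dom} f$; * $\nabla f$ is locally Lipschitz continuous on $\operatorname{int}\operatorname{dom} f$. For $Y\in\mathbb{S}^n_{++}$ let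 $$D_k(X,Y)=\gamma_{1,k}\det(Y)^r\Bigl(-\log\frac{\det X}{\det Y}+\langle X,Y^{-1}\rangle-n\Bigr)+\frac{\gamma_{2,k}}{2}\|X-Y\|^2$$ if $X\in\mathbb{S}^n_{++}$, and $D_k(X,Y)=\infty$ otherwise. Put $F=f+\delta$. Let $\{X^k\}_{k\ge0}$ be an infinite sequence generated by the generalized variable distance proximal gradient method, with parameters $\beta>1$, $0<\sigma<1$, $0<p\le1$. That is, $X^0\in\mathbb{S}^n_{++}$ and $F_0=F(X^0)$, and for every $k\ge0$ the following holds. For $i=0,1,2,\dots$ one takes a trial point $$X^{k,i}\in\operatorname*{argmin}_{X\in\mathbb{S}^n}\bigl\{f(X^k)+\langle\nabla f(X^k),X-X^k\rangle+\beta^iD_k(X,X^k)+\delta(X)\bigr\};$$ $i_k$ is the smallest $i$ with $F(X^{k,i})\le F_k-\sigma\beta^iD_k(X^{k,i},X^k)$; and $X^{k+1}=X^{k,i_k}$, $F_{k+1}=p_{k+1}F(X^{k+1})+(1-p_{k+1})F_k$ for some $p_{k+1}\in[p,1]$. Then every accumulation point $X^*$ of $\{X^k\}$, whether in $\mathbb{S}^n_{++}$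 or on the boundary of $\mathbb{S}^n_+$, is an F-stationary point of the problem of minimizing $f$ over $\mathbb{S}^n_+$, that is, $F(X^*)<\infty$ and $0$ belongs to the Fréchet subdifferential of $F$ at $X^*$: $$\liminf_{Y\to X^*,\,Y\ne X^*}\frac{F(Y)-F(X^*)}{\|Y-X^*\|}\ge0.$$ -/

import Mathlib

open Filter Topology Set
open scoped InnerProductSpace

noncomputable section

namespace ProxGrad

/-! ### Extended-real-valued functions on an inner product space

A function with values in `(-∞, ∞]` is a map into `EReal` that never takes the value `⊥`. -/

/-- The effective domain `{x | φ x < ∞}`. -/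
def dom {E : Type*} (φ : E → EReal) : Set E := {x | φ x < ⊤}

open Classical in
/-- The indicator function of a set in the sense of convex analysis: `0` on `A` and `∞` off `A`. -/
def indicatorFn {E : Type*} (A : Set E) (x : E) : EReal := if x ∈ A then 0 else ⊤

/-- The set of global minimizers of `φ`. -/
def argmin {E : Type*} (φ : E → EReal) : Set E := {x | ∀ z, φ x ≤ φ z}

section InnerProduct

variable {E : Type*} [NormedAddCommGroup E] [InnerProductSpace ℝ E]

/-- The Fréchet subdifferential of `φ` at `x`: all `g` with
`liminf_{y → x, y ≠ x} (φ y - φ x - ⟪g, y - x⟫) / ‖y - x‖ ≥ 0`.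
It is meant for points `x` where `φ x` is finite. -/
def frechetSubdifferential (φ : E → EReal) (x : E) : Set E :=
  {g | 0 ≤ liminf (fun y : E => (φ y - φ x - ((⟪g, y - x⟫_ℝ : ℝ) : EReal)) / ((‖y - x‖ : ℝ) : EReal))
    (𝓝[≠] x)}

/-- `x` is an F-stationary point of the problem of minimizing `φ`. -/
def IsFStationary (φ : E → EReal) (x : E) : Prop :=
  x ∈ dom φ ∧ (0 : E) ∈ frechetSubdifferential φ x

variable [CompleteSpace E]

/-- The gradient of an extended-real-valued function, at points in the interior of its domain
where it is differentiable. -/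
def grad (f : E → EReal) : E → E := gradient fun x => (f x).toReal

/-- The objective of the proximal subproblem at the point `y` with proximal parameter `b`,
`x ↦ f y + ⟪∇f y, x - y⟫ + b D(x, y) + g x`. -/
def proxObjective (f g : E → EReal) (D : E → E → EReal) (b : ℝ) (y x : E) : EReal :=
  f y + ((⟪grad f y, x - y⟫_ℝ : ℝ) : EReal) + (b : EReal) * D x y + g x

/-- A (nonterminating) run of the generalized variable distance proximal gradient method for
minimizing `F = f + g`, with parameters `β`, `σ`, `p`.  Here

* `D k` is the distance used at iteration `k`;
* `trial k i` is the trial point `x^{k,i}`, a minimizer of the subproblem with parameter `β ^ i`;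
* `idx k` is the smallest `i` for which the trial point is accepted;
* `Fref k` is the averaged reference value `F_k`, with averaging weights `wt k = p_k`;
* `x k` is the `k`-th iterate. -/
structure IsRun (f g : E → EReal) (C : Set E) (D : ℕ → E → E → EReal) (β σ p : ℝ)
    (wt : ℕ → ℝ) (Fref : ℕ → EReal) (trial : ℕ → ℕ → E) (idx : ℕ → ℕ) (x : ℕ → E) : Prop where
  one_lt_beta : 1 < β
  sigma_pos : 0 < σ
  sigma_lt_one : σ < 1
  p_pos : 0 < p
  p_le_one : p ≤ 1
  init_mem : x 0 ∈ C ∩ dom g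
  ref_zero : Fref 0 = f (x 0) + g (x 0)
  trial_mem : ∀ k, ∀ i ≤ idx k, trial k i ∈ argmin (proxObjective f g (D k) (β ^ i) (x k))
  accept : ∀ k, f (trial k (idx k)) + g (trial k (idx k)) ≤
    Fref k - ((σ * β ^ idx k : ℝ) : EReal) * D k (trial k (idx k)) (x k)
  reject : ∀ k, ∀ i < idx k, ¬ (f (trial k i) + g (trial k i) ≤
    Fref k - ((σ * β ^ i : ℝ) : EReal) * D k (trial k i) (x k))
  weight_mem : ∀ k, wt (k + 1) ∈ Icc p 1
  step : ∀ k, x (k + 1) = trial k (idx k)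
  ref_succ : ∀ k, Fref (k + 1) =
    (wt (k + 1) : EReal) * (f (x (k + 1)) + g (x (k + 1))) + ((1 - wt (k + 1) : ℝ) : EReal) * Fref k

/-- `x` is a sequence generated by the generalized variable distance proximal gradient method. -/
def IsGeneratedSequence (f g : E → EReal) (C : Set E) (D : ℕ → E → E → EReal)
    (x : ℕ → E) : Prop :=
  ∃ (β σ p : ℝ) (wt : ℕ → ℝ) (Fref : ℕ → EReal) (trial : ℕ → ℕ → E) (idx : ℕ → ℕ),
    IsRun f g C D β σ p wt Fref trial idx x

end InnerProduct

/-! ### Symmetric matrices with the trace inner product -/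

/-- The real symmetric `n × n` matrices, as a subspace of the Euclidean space of all `n × n`
arrays.  The inner product inherited from there is `⟪X, Y⟫ = ∑ i j, X i j * Y i j = tr (X Y)`, and
the norm is the Frobenius norm. -/
def symSubmodule (n : ℕ) : Submodule ℝ (EuclideanSpace ℝ (Fin n × Fin n)) where
  carrier := {X | ∀ i j, X (i, j) = X (j, i)}
  zero_mem' := fun _ _ => rfl
  add_mem' := fun {X Y} hX hY i j => by simp [hX i j, hY i j]
  smul_mem' := fun c X hX i j => by simp [hX i j]

/-- The inner product space `𝕊ⁿ` of real symmetric `n × n` matrices. -/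
abbrev SymMat (n : ℕ) : Type := symSubmodule n

instance (n : ℕ) : CompleteSpace (SymMat n) := FiniteDimensional.complete ℝ (SymMat n)

/-- The underlying matrix. -/
def SymMat.toMatrix {n : ℕ} (X : SymMat n) : Matrix (Fin n) (Fin n) ℝ :=
  Matrix.of fun i j => X.1 (i, j)

theorem SymMat.isHermitian {n : ℕ} (X : SymMat n) : X.toMatrix.IsHermitian := by
  ext i j
  simpa [SymMat.toMatrix] using (X.2 i j).symm

theorem SymMat.inner_eq_trace {n : ℕ} (X Y : SymMat n) :
    ⟪X, Y⟫_ℝ = (X.toMatrix * Y.toMatrix).trace := by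
  simp only [Submodule.coe_inner, PiLp.inner_apply, Fintype.sum_prod_type, Matrix.trace,
    Matrix.diag, Matrix.mul_apply, SymMat.toMatrix, Matrix.of_apply]
  refine Finset.sum_congr rfl fun i _ => Finset.sum_congr rfl fun j _ => ?_
  rw [Y.2 j i]
  simp [mul_comm]

/-- The positive semidefinite cone `𝕊ⁿ₊`. -/
def psdCone (n : ℕ) : Set (SymMat n) := {X | X.toMatrix.PosSemidef}

/-- The cone `𝕊ⁿ₊₊` of positive definite matrices. -/
def pdCone (n : ℕ) : Set (SymMat n) := {X | X.toMatrix.PosDef}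

/-- The positive definite matrices form the interior of the positive semidefinite cone. -/
theorem interior_psdCone (n : ℕ) : interior (psdCone n) = pdCone n := by
  have key : ∀ (X : SymMat n) (v : Fin n → ℝ),
      star v ⬝ᵥ (X.toMatrix.mulVec v) = ∑ i, ∑ j, v i * X.1 (i, j) * v j := by
    intro X v
    simp [dotProduct, Matrix.mulVec, SymMat.toMatrix, Finset.mul_sum, mul_assoc]
  apply Subset.antisymm
  · intro X hX
    let J : SymMat n := ⟨WithLp.toLp 2 fun q => if q.1 = q.2 then 1 else 0, fun i j => by
      simp [eq_comm]⟩
    have hcont : Continuous fun t : ℝ => X - t • J := by fun_prop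
    have h0 : ∀ᶠ t in 𝓝 (0 : ℝ), X - t • J ∈ psdCone n := by
      have := hcont.continuousAt (x := 0) |>.tendsto
      simp only [zero_smul, sub_zero] at this
      exact this (mem_interior_iff_mem_nhds.1 hX)
    obtain ⟨t, ht, htpos⟩ := ((h0.filter_mono nhdsWithin_le_nhds).and
      (self_mem_nhdsWithin : Ioi (0 : ℝ) ∈ 𝓝[>] 0)).exists
    have h1 : X.toMatrix = (X - t • J).toMatrix + t • (1 : Matrix (Fin n) (Fin n) ℝ) := by
      ext i j
      simp [SymMat.toMatrix, J, Matrix.one_apply]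
    change X.toMatrix.PosDef
    rw [h1]
    exact Matrix.PosDef.posSemidef_add ht (Matrix.PosDef.one.smul htpos)
  · have hsub : pdCone n ⊆ psdCone n := fun X hX => Matrix.PosDef.posSemidef hX
    refine interior_maximal hsub ?_
    let S : Set (Fin n → ℝ) := Metric.sphere 0 1
    let G : SymMat n → (Fin n → ℝ) → ℝ := fun X v => ∑ i, ∑ j, v i * X.1 (i, j) * v j
    have hS : IsCompact S := isCompact_sphere _ _
    have hG : Continuous fun q : SymMat n × (Fin n → ℝ) => G q.1 q.2 := by
      simp only [G]; fun_prop
    have heq : pdCone n = {X | ∀ v ∈ S, 0 < G X v} := by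
      ext X
      constructor
      · intro hX v hv
        have := (Matrix.PosDef.dotProduct_mulVec_pos hX (x := v) (by
          rintro rfl; simp [S] at hv))
        rw [key] at this; exact this
      · intro h
        refine Matrix.PosDef.of_dotProduct_mulVec_pos X.isHermitian fun v hv => ?_
        rw [key]
        have hn : 0 < ‖v‖ := norm_pos_iff.2 hv
        have := h (‖v‖⁻¹ • v) (by simp [S, norm_smul, hn.ne'])
        have e : G X (‖v‖⁻¹ • v) = ‖v‖⁻¹ ^ 2 * ∑ i, ∑ j, v i * X.1 (i, j) * v j := by
          simp only [G, Finset.mul_sum, Pi.smul_apply, smul_eq_mul]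
          refine Finset.sum_congr rfl fun i _ => Finset.sum_congr rfl fun j _ => by ring
        rw [e] at this
        exact (pos_iff_pos_of_mul_pos this).1 (by positivity)
    rw [heq, isOpen_iff_mem_nhds]
    intro X hX
    have := hS.eventually_forall_of_forall_eventually (x₀ := X)
      (P := fun Y v => 0 < G Y v) (fun v hv => hG.continuousAt.eventually
        (lt_mem_nhds (hX v hv)))
    exact this

open Classical in
/-- The distance
`γ₁ det(Y)^r (-log (det X / det Y) + ⟨X, Y⁻¹⟩ - n) + (γ₂ / 2) ‖X - Y‖²`
for positive definite `X` and `Y`.  Its value is `∞` if `X` is not positive definite, in accordance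
with `-log 0 = ∞` on the boundary of the cone. -/
def pdDist {n : ℕ} (r γ₁ γ₂ : ℝ) (X Y : SymMat n) : EReal :=
  if X ∈ pdCone n then
    ((γ₁ * Y.toMatrix.det ^ r *
        (-Real.log (X.toMatrix.det / Y.toMatrix.det) + (X.toMatrix * Y.toMatrix⁻¹).trace - n)
      + γ₂ / 2 * ‖X - Y‖ ^ 2 : ℝ) : EReal)
  else ⊤

end ProxGrad

end

/-! Averaging the reference values keeps the descent: `F_k` is nonincreasing and bounded below, so
`β^{i_k} D_k(X^{k+1}, X^k) → 0`, and the quadratic part of `D_k` gives `X^{k+1} - X^k → 0`.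
By lower semicontinuity an accumulation point `X*` lies in `dom f ∩ 𝕊₊`, hence in `int (dom f)`,
where `∇f` is Lipschitz; there a large factor `β^i` is always accepted, so `β^{i_k}` stays bounded
as long as `X^k` is close to `X*`.

The first-order condition of the subproblem at `T = X^{k+1}`, with `S = X^k` and in the direction
`Z - T` for a fixed `Z ∈ 𝕊₊`, contains the term
`det(S)^r (tr((Z - T) S⁻¹) - tr((Z - T) T⁻¹)) ≤ det(S)^r (tr(Z S⁻¹) + n)`. Only an upper bound is
needed, so the uncontrolled inverse `T⁻¹` is harmless, and if `X*` is on the boundary the right-hand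
side tends to `0` because `det(S)^r S⁻¹ = det(S)^(r-1) adj(S)` with `r > 1`. In the limit
`⟨∇f(X*), Z - X*⟩ ≥ 0` for all `Z ∈ 𝕊₊`, which is stationarity. -/

namespace ProxGrad

/-! ### Determinants and traces of positive definite matrices -/

section Matrix

variable {ι : Type*} [Fintype ι]

open scoped ComplexOrder MatrixOrder in
theorem trace_mul_nonneg {𝕜 : Type*} [RCLike 𝕜] {A B : Matrix ι ι 𝕜} (hA : A.PosSemidef)
    (hB : B.PosSemidef) : 0 ≤ (A * B).trace := by
  classical
  obtain ⟨C, rfl⟩ := CStarAlgebra.nonneg_iff_eq_star_mul_self.mp hA.nonneg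
  rw [Matrix.mul_assoc, Matrix.trace_mul_comm]
  exact (hB.mul_mul_conjTranspose_same C).trace_nonneg

variable [DecidableEq ι]

theorem log_det_le_trace_sub_card {A : Matrix ι ι ℝ} (hA : A.PosDef) :
    Real.log A.det ≤ A.trace - Fintype.card ι := by
  have hdet : A.det = ∏ i, hA.1.eigenvalues i := by simp [hA.1.det_eq_prod_eigenvalues]
  have htrace : A.trace = ∑ i, hA.1.eigenvalues i := by simp [hA.1.trace_eq_sum_eigenvalues]
  calc Real.log A.det
      = ∑ i, Real.log (hA.1.eigenvalues i) := by
        rw [hdet, Real.log_prod fun i _ => (hA.eigenvalues_pos i).ne']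
    _ ≤ ∑ i, (hA.1.eigenvalues i - 1) :=
        Finset.sum_le_sum fun i _ => Real.log_le_sub_one_of_pos (hA.eigenvalues_pos i)
    _ = A.trace - Fintype.card ι := by simp [htrace]

open scoped MatrixOrder in
theorem log_det_div_det_le_trace_mul_inv_sub_card {A B : Matrix ι ι ℝ} (hA : A.PosDef)
    (hB : B.PosDef) : Real.log (A.det / B.det) ≤ (A * B⁻¹).trace - Fintype.card ι := by
  obtain ⟨C, hC, hBC⟩ :=
    CStarAlgebra.isStrictlyPositive_iff_eq_star_mul_self.mp hB.inv.isStrictlyPositive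
  have hdet : (C * A * star C).det = A.det / B.det := by
    rw [Matrix.det_mul, Matrix.det_mul, div_eq_mul_inv, ← Ring.inverse_eq_inv',
      ← Matrix.det_nonsing_inv, hBC, Matrix.det_mul]
    ring
  have htrace : (C * A * star C).trace = (A * B⁻¹).trace := by
    rw [Matrix.mul_assoc, Matrix.trace_mul_comm, Matrix.mul_assoc, ← hBC]
  rw [← hdet, ← htrace]
  exact log_det_le_trace_sub_card ((Matrix.IsUnit.posDef_star_right_conjugate_iff hC).2 hA)

theorem hasDerivAt_det_add_smul {𝕜 : Type*} [NontriviallyNormedField 𝕜] {A : Matrix ι ι 𝕜}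
    (hA : A.det ≠ 0) (B : Matrix ι ι 𝕜) :
    HasDerivAt (fun t : 𝕜 => (A + t • B).det) ((B * A⁻¹).trace * A.det) 0 := by
  set q := (Matrix.det (1 + (Polynomial.X : Polynomial 𝕜) • (B * A⁻¹).map Polynomial.C)).divX.divX
  have hexpand : (fun t : 𝕜 => (A + t • B).det) =
      fun t => (1 + (B * A⁻¹).trace * t + q.eval t * t ^ 2) * A.det := by
    funext t
    have hfactor : A + t • B = (1 + t • (B * A⁻¹)) * A := by
      rw [Matrix.add_mul, Matrix.one_mul, Matrix.smul_mul, Matrix.mul_assoc,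
        Matrix.nonsing_inv_mul A hA.isUnit, Matrix.mul_one]
    rw [hfactor, Matrix.det_mul, Matrix.det_one_add_smul]
  rw [hexpand]
  have h := (((hasDerivAt_id (0 : 𝕜)).const_mul (B * A⁻¹).trace).const_add 1).add
    ((q.hasDerivAt 0).mul (hasDerivAt_pow 2 (0 : 𝕜)))
  simpa using h.mul_const A.det

theorem hasDerivAt_log_det_add_smul_div {A : Matrix ι ι ℝ} (hA : A.det ≠ 0) (B : Matrix ι ι ℝ)
    {c : ℝ} (hc : c ≠ 0) :
    HasDerivAt (fun t : ℝ => Real.log ((A + t • B).det / c)) (B * A⁻¹).trace 0 := by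
  have h := ((hasDerivAt_det_add_smul hA B).div_const c).log (by simp [hA, hc])
  simp only [zero_smul, add_zero] at h
  convert h using 1
  field_simp

theorem trace_sub_mul_inv_sub_trace_sub_mul_inv_le {S T Z : Matrix ι ι ℝ} (hS : S.PosDef)
    (hT : T.PosDef) (hZ : Z.PosSemidef) :
    ((Z - T) * S⁻¹).trace - ((Z - T) * T⁻¹).trace ≤ (Z * S⁻¹).trace + Fintype.card ι := by
  have hTS : 0 ≤ (T * S⁻¹).trace := trace_mul_nonneg hT.posSemidef hS.inv.posSemidef
  have hZT : 0 ≤ (Z * T⁻¹).trace := trace_mul_nonneg hZ hT.inv.posSemidef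
  have hTT : (T * T⁻¹).trace = Fintype.card ι := by
    rw [Matrix.mul_nonsing_inv T hT.det_pos.ne'.isUnit, Matrix.trace_one]
  rw [Matrix.sub_mul, Matrix.sub_mul, Matrix.trace_sub, Matrix.trace_sub, hTT]
  linarith

variable {α : Type*} {l : Filter α} {S T : α → Matrix ι ι ℝ} {A : Matrix ι ι ℝ} {r : ℝ}

theorem tendsto_inv_of_det_ne_zero (hA : A.det ≠ 0) (hS : Tendsto S l (𝓝 A)) :
    Tendsto (fun a => (S a)⁻¹) l (𝓝 A⁻¹) := by
  refine (continuousAt_matrix_inv A ?_).tendsto.comp hS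
  simpa only [Ring.inverse_eq_inv'] using continuousAt_inv₀ hA

theorem tendsto_det_rpow (hS : Tendsto S l (𝓝 A)) (hr : A.det ≠ 0 ∨ 0 ≤ r) :
    Tendsto (fun a => (S a).det ^ r) l (𝓝 (A.det ^ r)) :=
  (Real.continuousAt_rpow_const _ _ hr).tendsto.comp
    ((continuous_id.matrix_det.tendsto A).comp hS)

/-- Here `r > 1` enters: `det S ^ r * S⁻¹ = det S ^ (r - 1) * adj S`. -/
theorem tendsto_det_rpow_mul_trace_mul_inv_of_det_eq_zero (hr : 1 < r) (hA : A.det = 0)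
    (hS : Tendsto S l (𝓝 A)) (hSpos : ∀ᶠ a in l, 0 < (S a).det) (Z : Matrix ι ι ℝ) :
    Tendsto (fun a => (S a).det ^ r * (Z * (S a)⁻¹).trace) l (𝓝 0) := by
  have hadj : Tendsto (fun a => (Z * (S a).adjugate).trace) l (𝓝 (Z * A.adjugate).trace) :=
    ((continuous_const.mul continuous_id.matrix_adjugate).matrix_trace.tendsto A).comp hS
  have hlim := (tendsto_det_rpow hS (Or.inr (sub_pos.2 hr).le)).mul hadj
  rw [hA, Real.zero_rpow (sub_pos.2 hr).ne', zero_mul] at hlim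
  refine hlim.congr' ?_
  filter_upwards [hSpos] with a ha
  rw [Real.rpow_sub_one ha.ne', Matrix.inv_def, Ring.inverse_eq_inv', Matrix.mul_smul,
    Matrix.trace_smul, smul_eq_mul]
  ring

theorem tendsto_det_rpow_mul_trace_sub_of_det_ne_zero (hA : A.det ≠ 0) (hS : Tendsto S l (𝓝 A))
    (hT : Tendsto T l (𝓝 A)) (Z : Matrix ι ι ℝ) :
    Tendsto (fun a => (S a).det ^ r *
      (((Z - T a) * (S a)⁻¹).trace - ((Z - T a) * (T a)⁻¹).trace)) l (𝓝 0) := by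
  have htrace {W : α → Matrix ι ι ℝ} (hW : Tendsto W l (𝓝 A)) :
      Tendsto (fun a => ((Z - T a) * (W a)⁻¹).trace) l (𝓝 ((Z - A) * A⁻¹).trace) :=
    (continuous_id.matrix_trace.tendsto _).comp
      ((hT.const_sub Z).mul (tendsto_inv_of_det_ne_zero hA hW))
  simpa using (tendsto_det_rpow hS (Or.inl hA)).mul ((htrace hS).sub (htrace hT))

theorem eventually_det_rpow_mul_trace_sub_lt (hr : 1 < r) (hS : Tendsto S l (𝓝 A))
    (hT : Tendsto T l (𝓝 A)) (hSpd : ∀ᶠ a in l, (S a).PosDef) (hTpd : ∀ᶠ a in l, (T a).PosDef)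
    {Z : Matrix ι ι ℝ} (hZ : Z.PosSemidef) {ε : ℝ} (hε : 0 < ε) :
    ∀ᶠ a in l, (S a).det ^ r *
      (((Z - T a) * (S a)⁻¹).trace - ((Z - T a) * (T a)⁻¹).trace) < ε := by
  by_cases hA : A.det = 0
  · have hr0 : 0 < r := one_pos.trans hr
    have hbound : Tendsto (fun a => (S a).det ^ r * (Z * (S a)⁻¹).trace +
        (S a).det ^ r * Fintype.card ι) l (𝓝 0) := by
      have hdet := (tendsto_det_rpow hS (Or.inr hr0.le)).mul_const (Fintype.card ι : ℝ)
      rw [hA, Real.zero_rpow hr0.ne', zero_mul] at hdet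
      simpa using (tendsto_det_rpow_mul_trace_mul_inv_of_det_eq_zero hr hA hS
        (hSpd.mono fun a ha => ha.det_pos) Z).add hdet
    filter_upwards [hbound.eventually_lt_const hε, hSpd, hTpd] with a ha hSa hTa
    refine lt_of_le_of_lt ?_ ha
    rw [← mul_add]
    exact mul_le_mul_of_nonneg_left (trace_sub_mul_inv_sub_trace_sub_mul_inv_le hSa hTa hZ)
      (Real.rpow_nonneg hSa.det_pos.le r)
  · exact (tendsto_det_rpow_mul_trace_sub_of_det_ne_zero hA hS hT Z).eventually_lt_const hε

end Matrix

/-! ### Smooth functions and stationarity -/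

section ExtendedReal

variable {E : Type*} {f : E → EReal} {A : Set E} {x : E}

theorem coe_toReal_of_mem_dom (hf : f x ≠ ⊥) (hx : x ∈ dom f) : ((f x).toReal : EReal) = f x :=
  EReal.coe_toReal (ne_of_lt hx) hf

theorem indicatorFn_of_mem (hx : x ∈ A) : indicatorFn A x = 0 :=
  if_pos hx

theorem indicatorFn_of_notMem (hx : x ∉ A) : indicatorFn A x = ⊤ :=
  if_neg hx

theorem add_indicatorFn_of_mem (hx : x ∈ A) : f x + indicatorFn A x = f x := by
  rw [indicatorFn_of_mem hx, add_zero]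

theorem indicatorFn_ne_bot : indicatorFn A x ≠ ⊥ := by
  unfold indicatorFn
  split_ifs <;> simp

end ExtendedReal

section Smooth

variable {E : Type*} [NormedAddCommGroup E] [InnerProductSpace ℝ E] [CompleteSpace E]

theorem le_add_inner_add_sq_of_lipschitzOnWith {φ : E → ℝ} {G : E → E} {s : Set E} {K : NNReal}
    (hs : Convex ℝ s) (hφ : ∀ x ∈ s, HasGradientAt φ (G x) x) (hG : LipschitzOnWith K G s)
    {y z : E} (hy : y ∈ s) (hz : z ∈ s) :
    φ z ≤ φ y + ⟪G y, z - y⟫_ℝ + K / 2 * ‖z - y‖ ^ 2 := by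
  set v := z - y with hv
  have hmem : ∀ t ∈ Icc (0 : ℝ) 1, y + t • v ∈ s := fun t ht => hs.add_smul_sub_mem hy hz ht
  have hderiv : ∀ t ∈ Icc (0 : ℝ) 1,
      HasDerivAt (fun t : ℝ => φ (y + t • v)) ⟪G (y + t • v), v⟫_ℝ t := fun t ht => by
    have hline : HasDerivAt (fun t : ℝ => y + t • v) v t := by
      simpa using ((hasDerivAt_id t).smul_const v).const_add y
    simpa [Function.comp_def] using
      (hφ _ (hmem t ht)).hasFDerivAt.comp_hasDerivAt t hline
  have hquad : ∀ t : ℝ, HasDerivAt (fun t : ℝ => φ y + ⟪G y, v⟫_ℝ * t + K / 2 * ‖v‖ ^ 2 * t ^ 2)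
      (⟪G y, v⟫_ℝ + K * ‖v‖ ^ 2 * t) t := fun t => by
    have h := (((hasDerivAt_id t).const_mul ⟪G y, v⟫_ℝ).const_add (φ y)).add
      ((hasDerivAt_pow 2 t).const_mul (K / 2 * ‖v‖ ^ 2))
    exact h.congr_deriv (by push_cast; ring)
  have hslope : ∀ t ∈ Icc (0 : ℝ) 1,
      ⟪G (y + t • v), v⟫_ℝ ≤ ⟪G y, v⟫_ℝ + K * ‖v‖ ^ 2 * t := fun t ht => by
    rw [← sub_le_iff_le_add', ← inner_sub_left]
    calc ⟪G (y + t • v) - G y, v⟫_ℝ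
        ≤ ‖G (y + t • v) - G y‖ * ‖v‖ := real_inner_le_norm _ _
      _ ≤ K * ‖y + t • v - y‖ * ‖v‖ := by
        gcongr
        exact hG.norm_sub_le (hmem t ht) hy
      _ = K * ‖v‖ ^ 2 * t := by
        rw [add_sub_cancel_left, norm_smul, Real.norm_of_nonneg ht.1]
        ring
  have hle := image_le_of_deriv_right_le_deriv_boundary
    (fun t ht => (hderiv t ht).continuousAt.continuousWithinAt)
    (fun t ht => (hderiv t (Ico_subset_Icc_self ht)).hasDerivWithinAt) (by simp)
    (fun t _ => (hquad t).continuousAt.continuousWithinAt)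
    (fun t _ => (hquad t).hasDerivWithinAt)
    (fun t ht => hslope t (Ico_subset_Icc_self ht)) (right_mem_Icc.2 zero_le_one)
  simpa [hv] using hle

theorem exists_ball_norm_le_and_le_add_inner_add_sq {φ : E → ℝ} {G : E → E} {U : Set E}
    (hU : IsOpen U) (hφ : ∀ x ∈ U, HasGradientAt φ (G x) x) (hG : LocallyLipschitzOn U G)
    {x : E} (hx : x ∈ U) :
    ∃ ρ > 0, ∃ L M : ℝ, (∀ y ∈ Metric.ball x ρ, ‖G y‖ ≤ M) ∧
      ∀ y ∈ Metric.ball x ρ, ∀ z ∈ Metric.ball x ρ,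
        φ z ≤ φ y + ⟪G y, z - y⟫_ℝ + L / 2 * ‖z - y‖ ^ 2 := by
  obtain ⟨K, t, ht, hK⟩ := hG hx
  rw [hU.nhdsWithin_eq hx] at ht
  have hbdd : ∀ᶠ y in 𝓝 x, ‖G y‖ < ‖G x‖ + 1 :=
    (hG.continuousOn.continuousAt (hU.mem_nhds hx)).norm.eventually_lt_const (lt_add_one _)
  obtain ⟨ρ, hρ, hball⟩ :=
    Metric.mem_nhds_iff.1 (inter_mem (inter_mem ht (hU.mem_nhds hx)) hbdd)
  exact ⟨ρ, hρ, K, ‖G x‖ + 1, fun y hy => (hball hy).2.le, fun y hy z hz =>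
    le_add_inner_add_sq_of_lipschitzOnWith (convex_ball x ρ) (fun w hw => hφ w (hball hw).1.2)
      (hK.mono fun w hw => (hball hw).1.1) hy hz⟩

theorem isFStationary_add_indicatorFn {f : E → EReal} {A : Set E} {x : E}
    (hf : ∀ z, f z ≠ ⊥) (hx : x ∈ interior (dom f))
    (hdiff : DifferentiableAt ℝ (fun z => (f z).toReal) x) (hxA : x ∈ A)
    (hvi : ∀ z ∈ A, 0 ≤ ⟪grad f x, z - x⟫_ℝ) :
    IsFStationary (fun z => f z + indicatorFn A z) x := by
  have hxd : x ∈ dom f := interior_subset hx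
  refine ⟨by simpa [dom, indicatorFn_of_mem hxA] using hxd, ?_⟩
  simp only [frechetSubdifferential, mem_ofPred_eq, inner_zero_left, EReal.coe_zero, sub_zero]
  refine le_of_forall_lt fun c hc => ?_
  obtain ⟨e, hce, he⟩ := EReal.lt_iff_exists_real_btwn.1 hc
  rw [EReal.coe_neg'] at he
  refine hce.trans_le (le_liminf_of_le (by isBoundedDefault) ?_)
  have hgrad : ∀ᶠ y in 𝓝 x, |(f y).toReal - (f x).toReal - ⟪grad f x, y - x⟫_ℝ| ≤
      -e * ‖y - x‖ := by
    simpa only [grad, InnerProductSpace.toDual_apply_apply, Real.norm_eq_abs] using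
      (hasFDerivAt_iff_isLittleO.1 hdiff.hasGradientAt.hasFDerivAt).def (neg_pos.2 he)
  filter_upwards [nhdsWithin_le_nhds hgrad, nhdsWithin_le_nhds (isOpen_interior.mem_nhds hx),
    self_mem_nhdsWithin] with y hy hyd hyx
  have hpos : 0 < ‖y - x‖ := norm_pos_iff.2 (sub_ne_zero.2 hyx)
  rw [add_indicatorFn_of_mem hxA, ← coe_toReal_of_mem_dom (hf x) hxd]
  by_cases hyA : y ∈ A
  · rw [add_indicatorFn_of_mem hyA, ← coe_toReal_of_mem_dom (hf y) (interior_subset hyd),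
      ← EReal.coe_sub, ← EReal.coe_div, EReal.coe_le_coe_iff, le_div_iff₀ hpos]
    linarith [(abs_le.1 hy).1, hvi y hyA]
  · rw [indicatorFn_of_notMem hyA, EReal.add_top_of_ne_bot (hf y), EReal.top_sub_coe,
      EReal.top_div_of_pos_ne_top (EReal.coe_pos.2 hpos) (EReal.coe_ne_top _)]
    exact le_top

end Smooth

/-! ### Descent with averaged reference values -/

/-- A real sequence `a` satisfying the averaged (nonmonotone) sufficient descent condition with
decreases `e k ≥ 0`: the reference values `R k` start at `a 0` and are updated by convex
combinations in which the newest value has weight at least `p > 0`. -/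
structure IsAveragedDescent (a R e : ℕ → ℝ) (p : ℝ) : Prop where
  p_pos : 0 < p
  nonneg : ∀ k, 0 ≤ e k
  ref_zero : R 0 = a 0
  ref_succ : ∀ k, ∃ w ∈ Icc p 1, R (k + 1) = w * a (k + 1) + (1 - w) * R k
  descent : ∀ k, a (k + 1) ≤ R k - e k

namespace IsAveragedDescent

variable {a R e : ℕ → ℝ} {p : ℝ}

theorem le_ref (h : IsAveragedDescent a R e p) : ∀ k, a k ≤ R k
  | 0 => h.ref_zero.ge
  | k + 1 => by
    obtain ⟨w, hw, hR⟩ := h.ref_succ k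
    have hmul := mul_nonneg (sub_nonneg.2 hw.2)
      (sub_nonneg.2 ((h.descent k).trans (sub_le_self _ (h.nonneg k))))
    linarith

theorem mul_le_ref_sub_ref_succ (h : IsAveragedDescent a R e p) (k : ℕ) :
    p * e k ≤ R k - R (k + 1) := by
  obtain ⟨w, hw, hR⟩ := h.ref_succ k
  calc p * e k ≤ w * e k := mul_le_mul_of_nonneg_right hw.1 (h.nonneg k)
    _ ≤ w * (R k - a (k + 1)) :=
      mul_le_mul_of_nonneg_left (le_sub_comm.1 (h.descent k)) (h.p_pos.le.trans hw.1)
    _ = R k - R (k + 1) := by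
      rw [hR]
      ring

theorem antitone_ref (h : IsAveragedDescent a R e p) : Antitone R :=
  antitone_nat_of_succ_le fun k => sub_nonneg.1
    ((mul_nonneg h.p_pos.le (h.nonneg k)).trans (h.mul_le_ref_sub_ref_succ k))

theorem le_zero (h : IsAveragedDescent a R e p) (k : ℕ) : a k ≤ a 0 :=
  (h.le_ref k).trans ((h.antitone_ref (Nat.zero_le k)).trans_eq h.ref_zero)

theorem tendsto_zero (h : IsAveragedDescent a R e p) (ha : BddBelow (range a)) :
    Tendsto e atTop (𝓝 0) := by
  obtain ⟨m, hm⟩ := ha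
  have hbdd : BddBelow (range R) :=
    ⟨m, forall_mem_range.2 fun k => (hm (mem_range_self k)).trans (h.le_ref k)⟩
  have hlim := tendsto_atTop_ciInf h.antitone_ref hbdd
  have hdiff : Tendsto (fun k => (R k - R (k + 1)) / p) atTop (𝓝 0) := by
    simpa using (hlim.sub (hlim.comp (tendsto_add_atTop_nat 1))).div_const p
  exact squeeze_zero h.nonneg
    (fun k => (le_div_iff₀' h.p_pos).2 (h.mul_le_ref_sub_ref_succ k)) hdiff

end IsAveragedDescent

/-! ### Runs with an abstract proximal distance -/

section Run

variable {E : Type*} [NormedAddCommGroup E] [InnerProductSpace ℝ E]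

/-- What the convergence analysis needs to know about a distance with domain `C`: it is finite
exactly on `C`, vanishes on the diagonal, dominates `(μ / 2) ‖x - y‖²` and is differentiable along
lines in its first argument. -/
structure IsProximalDistance (C : Set E) (μ : ℝ) (D : E → E → EReal) : Prop where
  eq_top : ∀ x ∉ C, ∀ y ∈ C, D x y = ⊤
  ne_top : ∀ x ∈ C, ∀ y ∈ C, D x y ≠ ⊤
  self_eq_zero : ∀ y ∈ C, D y y = 0
  sq_norm_le : ∀ x ∈ C, ∀ y ∈ C, ((μ / 2 * ‖x - y‖ ^ 2 : ℝ) : EReal) ≤ D x y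
  lineDifferentiableAt : ∀ x ∈ C, ∀ y ∈ C, ∀ v,
    LineDifferentiableAt ℝ (fun z => (D z y).toReal) x v

/-- Near the point `x`, possibly on the boundary of `C`, the slopes of the distances `D k (·, y)`
at points `w ∈ C` towards any fixed point of `A` are at most `ε`, uniformly in `k`, once `w` and
`y` are close enough to `x`. This one-sided bound is all that is needed to pass to the limit in the
optimality conditions of the subproblems. -/
def HasAsymptoticallyNonposSlopes {ι : Type*} (A C : Set E) (D : ι → E → E → EReal) (x : E) :
    Prop :=
  ∀ z ∈ A, ∀ ε > 0, ∀ᶠ q in 𝓝[C ×ˢ C] (x, x), ∀ k,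
    lineDeriv ℝ (fun w => (D k w q.2).toReal) q.1 (z - q.1) ≤ ε

section Subproblem

variable {C : Set E} {μ b : ℝ} {D : E → E → EReal} {y z : E}

theorem IsProximalDistance.coe_toReal (hD : IsProximalDistance C μ D) (hz : z ∈ C) (hy : y ∈ C) :
    ((D z y).toReal : EReal) = D z y :=
  EReal.coe_toReal (hD.ne_top z hz y hy)
    (ne_bot_of_le_ne_bot (EReal.coe_ne_bot _) (hD.sq_norm_le z hz y hy))

theorem IsProximalDistance.sq_norm_le_toReal (hD : IsProximalDistance C μ D) (hz : z ∈ C)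
    (hy : y ∈ C) : μ / 2 * ‖z - y‖ ^ 2 ≤ (D z y).toReal := by
  rw [← EReal.coe_le_coe_iff, hD.coe_toReal hz hy]
  exact hD.sq_norm_le z hz y hy

variable [CompleteSpace E] {f : E → EReal} {A : Set E}

theorem proxObjective_indicatorFn_of_mem (hf : ∀ x, f x ≠ ⊥) (hC : C ⊆ dom f ∩ A)
    (hD : IsProximalDistance C μ D) (hy : y ∈ C) (hz : z ∈ C) :
    proxObjective f (indicatorFn A) D b y z =
      (((f y).toReal + ⟪grad f y, z - y⟫_ℝ + b * (D z y).toReal : ℝ) : EReal) := by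
  rw [proxObjective, indicatorFn_of_mem (hC hz).2, add_zero, EReal.coe_add, EReal.coe_add,
    EReal.coe_mul, coe_toReal_of_mem_dom (hf y) (hC hy).1, hD.coe_toReal hz hy]

theorem mem_of_mem_argmin_proxObjective (hf : ∀ x, f x ≠ ⊥) (hC : C ⊆ dom f ∩ A)
    (hD : IsProximalDistance C μ D) (hb : 0 < b) (hy : y ∈ C)
    (hz : z ∈ argmin (proxObjective f (indicatorFn A) D b y)) : z ∈ C := by
  by_contra hzC
  have hle := hz y
  rw [proxObjective_indicatorFn_of_mem hf hC hD hy hy, proxObjective, hD.eq_top z hzC y hy,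
    EReal.coe_mul_top_of_pos hb, ← coe_toReal_of_mem_dom (hf y) (hC hy).1, ← EReal.coe_add,
    EReal.coe_add_top, EReal.top_add_of_ne_bot indicatorFn_ne_bot] at hle
  exact EReal.coe_ne_top _ (top_le_iff.1 hle)

theorem isMinOn_of_mem_argmin_proxObjective (hf : ∀ x, f x ≠ ⊥) (hC : C ⊆ dom f ∩ A)
    (hD : IsProximalDistance C μ D) (hb : 0 < b) (hy : y ∈ C)
    (hz : z ∈ argmin (proxObjective f (indicatorFn A) D b y)) :
    IsMinOn (fun w => ⟪grad f y, w - y⟫_ℝ + b * (D w y).toReal) C z := fun w hw => by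
  have hzC := mem_of_mem_argmin_proxObjective hf hC hD hb hy hz
  have hle := hz w
  rw [proxObjective_indicatorFn_of_mem hf hC hD hy hzC,
    proxObjective_indicatorFn_of_mem hf hC hD hy hw, EReal.coe_le_coe_iff, add_assoc,
    add_assoc] at hle
  exact le_of_add_le_add_left hle

end Subproblem

namespace IsRun

variable [CompleteSpace E] {f : E → EReal} {A C : Set E} {μ β σ p : ℝ} {D : ℕ → E → E → EReal}
  {wt : ℕ → ℝ} {Fref : ℕ → EReal} {trial : ℕ → ℕ → E} {idx : ℕ → ℕ} {x : ℕ → E}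
  (hrun : IsRun f (indicatorFn A) C D β σ p wt Fref trial idx x) (hf : ∀ x, f x ≠ ⊥)
  (hC : C ⊆ dom f ∩ A) (hD : ∀ k, IsProximalDistance C μ (D k))

include hrun

theorem pow_beta_pos (i : ℕ) : 0 < β ^ i :=
  pow_pos (one_pos.trans hrun.one_lt_beta) i

include hf hC hD

theorem iterate_mem (k : ℕ) : x k ∈ C := by
  induction k with
  | zero => exact hrun.init_mem.1
  | succ k hk =>
    rw [hrun.step k]
    exact mem_of_mem_argmin_proxObjective hf hC (hD k) (hrun.pow_beta_pos _) hk
      (hrun.trial_mem k _ le_rfl)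

theorem trial_mem_of_le {k i : ℕ} (hi : i ≤ idx k) : trial k i ∈ C :=
  mem_of_mem_argmin_proxObjective hf hC (hD k) (hrun.pow_beta_pos i)
    (hrun.iterate_mem hf hC hD k) (hrun.trial_mem k i hi)

theorem isMinOn_trial {k i : ℕ} (hi : i ≤ idx k) :
    IsMinOn (fun w => ⟪grad f (x k), w - x k⟫_ℝ + β ^ i * (D k w (x k)).toReal) C (trial k i) :=
  isMinOn_of_mem_argmin_proxObjective hf hC (hD k) (hrun.pow_beta_pos i)
    (hrun.iterate_mem hf hC hD k) (hrun.trial_mem k i hi)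

theorem coe_toReal_ref (k : ℕ) : ((Fref k).toReal : EReal) = Fref k := by
  have hx := hrun.iterate_mem hf hC hD
  have hF : ∀ k, f (x k) + indicatorFn A (x k) = ((f (x k)).toReal : EReal) := fun k => by
    rw [add_indicatorFn_of_mem (hC (hx k)).2, coe_toReal_of_mem_dom (hf _) (hC (hx k)).1]
  induction k with
  | zero => rw [hrun.ref_zero, hF, EReal.toReal_coe]
  | succ k hk =>
    rw [hrun.ref_succ, hF, ← hk, ← EReal.coe_mul, ← EReal.coe_mul, ← EReal.coe_add,
      EReal.toReal_coe]

theorem accepted_iff {k : ℕ} {T : E} (hT : T ∈ C) (s : ℝ) :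
    f T + indicatorFn A T ≤ Fref k - (s : EReal) * D k T (x k) ↔
      (f T).toReal ≤ (Fref k).toReal - s * (D k T (x k)).toReal := by
  rw [add_indicatorFn_of_mem (hC hT).2, ← coe_toReal_of_mem_dom (hf T) (hC hT).1,
    ← hrun.coe_toReal_ref hf hC hD k, ← (hD k).coe_toReal hT (hrun.iterate_mem hf hC hD k)]
  norm_cast

theorem isAveragedDescent (hμ : 0 ≤ μ) :
    IsAveragedDescent (fun k => (f (x k)).toReal) (fun k => (Fref k).toReal)
      (fun k => σ * β ^ idx k * (D k (x (k + 1)) (x k)).toReal) p where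
  p_pos := hrun.p_pos
  nonneg k := by
    have hx := hrun.iterate_mem hf hC hD
    have hdist : 0 ≤ μ / 2 * ‖x (k + 1) - x k‖ ^ 2 := by positivity
    exact mul_nonneg (mul_pos hrun.sigma_pos (hrun.pow_beta_pos _)).le
      (hdist.trans ((hD k).sq_norm_le_toReal (hx (k + 1)) (hx k)))
  ref_zero := by
    rw [hrun.ref_zero, add_indicatorFn_of_mem (hC (hrun.iterate_mem hf hC hD 0)).2]
  ref_succ k := by
    have hx := hC (hrun.iterate_mem hf hC hD (k + 1))
    refine ⟨wt (k + 1), hrun.weight_mem k, ?_⟩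
    rw [hrun.ref_succ, add_indicatorFn_of_mem hx.2, ← coe_toReal_of_mem_dom (hf _) hx.1,
      ← hrun.coe_toReal_ref hf hC hD k]
    norm_cast
  descent k := by
    rw [hrun.step k]
    exact (hrun.accepted_iff hf hC hD (hrun.trial_mem_of_le hf hC hD le_rfl) _).1 (hrun.accept k)

theorem inner_add_mul_toReal_nonpos {k i : ℕ} (hi : i ≤ idx k) :
    ⟪grad f (x k), trial k i - x k⟫_ℝ + β ^ i * (D k (trial k i) (x k)).toReal ≤ 0 := by
  have hx := hrun.iterate_mem hf hC hD k
  simpa [(hD k).self_eq_zero _ hx] using isMinOn_iff.1 (hrun.isMinOn_trial hf hC hD hi) _ hx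

theorem pow_mul_norm_trial_sub_le {k i : ℕ} (hi : i ≤ idx k) :
    β ^ i * (μ / 2 * ‖trial k i - x k‖) ≤ ‖grad f (x k)‖ := by
  have hmin := hrun.inner_add_mul_toReal_nonpos hf hC hD hi
  have hcauchy := neg_le_of_abs_le (abs_real_inner_le_norm (grad f (x k)) (trial k i - x k))
  have hdist := mul_le_mul_of_nonneg_left ((hD k).sq_norm_le_toReal
    (hrun.trial_mem_of_le hf hC hD hi) (hrun.iterate_mem hf hC hD k)) (hrun.pow_beta_pos i).le
  rcases (norm_nonneg (trial k i - x k)).eq_or_lt' with hzero | hpos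
  · simp [hzero]
  · refine le_of_mul_le_mul_right ?_ hpos
    linarith

theorem mul_pow_mul_lt_of_lt_idx (hμ : 0 ≤ μ) {k i : ℕ} (hi : i < idx k) {L : ℝ}
    (hL : (f (trial k i)).toReal ≤ (f (x k)).toReal + ⟪grad f (x k), trial k i - x k⟫_ℝ +
      L / 2 * ‖trial k i - x k‖ ^ 2) :
    (1 - σ) * β ^ i * μ < L := by
  have hT := hrun.trial_mem_of_le hf hC hD hi.le
  have hrej := not_le.1 ((hrun.accepted_iff hf hC hD hT _).not.1 (hrun.reject k i hi))
  have href := (hrun.isAveragedDescent hf hC hD hμ).le_ref k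
  have hmin := hrun.inner_add_mul_toReal_nonpos hf hC hD hi.le
  have hdist := mul_le_mul_of_nonneg_left
    ((hD k).sq_norm_le_toReal hT (hrun.iterate_mem hf hC hD k))
    (mul_pos (sub_pos.2 hrun.sigma_lt_one) (hrun.pow_beta_pos i)).le
  refine lt_of_mul_lt_mul_right (a := ‖trial k i - x k‖ ^ 2 / 2) ?_ (by positivity)
  linarith

theorem exists_ball_pow_idx_le (hμ : 0 < μ)
    (hdiff : DifferentiableOn ℝ (fun z => (f z).toReal) (interior (dom f)))
    (hlip : LocallyLipschitzOn (interior (dom f)) (grad f)) {xs : E}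
    (hxs : xs ∈ interior (dom f)) :
    ∃ ρ > 0, ∃ B > 0, ∀ k, x k ∈ Metric.ball xs ρ → β ^ idx k ≤ B := by
  obtain ⟨ρ, hρ, L, M, hM, hL⟩ := exists_ball_norm_le_and_le_add_inner_add_sq isOpen_interior
    (fun z hz => (hdiff.differentiableAt (isOpen_interior.mem_nhds hz)).hasGradientAt) hlip hxs
  have hσ := sub_pos.2 hrun.sigma_lt_one
  set B := max (4 * M / (μ * ρ)) (L / ((1 - σ) * μ))
  have hrejected : ∀ k, x k ∈ Metric.ball xs (ρ / 2) → ∀ i < idx k, β ^ i ≤ B := by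
    intro k hk i hi
    by_contra! hB
    have hkρ := Metric.ball_subset_ball (half_le_self hρ.le) hk
    have hnear : dist (trial k i) (x k) < ρ / 2 := by
      by_contra! hfar
      have hle := (hrun.pow_mul_norm_trial_sub_le hf hC hD hi.le).trans (hM _ hkρ)
      rw [← dist_eq_norm] at hle
      have hmono : β ^ i * (μ / 2 * (ρ / 2)) ≤ β ^ i * (μ / 2 * dist (trial k i) (x k)) := by
        have := hrun.pow_beta_pos i
        gcongr
      have hlt := (div_lt_iff₀ (mul_pos hμ hρ)).1 ((le_max_left _ _).trans_lt hB)
      linarith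
    have hTρ : trial k i ∈ Metric.ball xs ρ :=
      (dist_triangle _ (x k) _).trans_lt ((add_lt_add hnear hk).trans_eq (add_halves ρ))
    have hlt := (div_lt_iff₀ (mul_pos hσ hμ)).1 ((le_max_right _ _).trans_lt hB)
    linarith [hrun.mul_pow_mul_lt_of_lt_idx hf hC hD hμ.le hi (hL _ hkρ _ hTρ)]
  refine ⟨ρ / 2, half_pos hρ, max 1 (β * B), lt_max_of_lt_left one_pos, fun k hk => ?_⟩
  cases hidx : idx k with
  | zero => simp
  | succ i =>
    rw [pow_succ']
    exact le_max_of_le_right (mul_le_mul_of_nonneg_left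
      (hrejected k hk i (hidx ▸ Nat.lt_succ_self i)) (one_pos.trans hrun.one_lt_beta).le)

theorem tendsto_norm_sub (hμ : 0 < μ) (hbdd : BddBelow (range fun k => (f (x k)).toReal)) :
    Tendsto (fun k => ‖x (k + 1) - x k‖) atTop (𝓝 0) := by
  have hx := hrun.iterate_mem hf hC hD
  have hc : 0 < σ * (μ / 2) := mul_pos hrun.sigma_pos (half_pos hμ)
  have hle : ∀ k, σ * (μ / 2) * ‖x (k + 1) - x k‖ ^ 2 ≤
      σ * β ^ idx k * (D k (x (k + 1)) (x k)).toReal := fun k => by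
    have hdist := (hD k).sq_norm_le_toReal (hx (k + 1)) (hx k)
    have hbeta : 1 ≤ β ^ idx k := one_le_pow₀ hrun.one_lt_beta.le
    calc σ * (μ / 2) * ‖x (k + 1) - x k‖ ^ 2
        = σ * 1 * (μ / 2 * ‖x (k + 1) - x k‖ ^ 2) := by ring
      _ ≤ σ * β ^ idx k * (D k (x (k + 1)) (x k)).toReal := by
        have := hrun.sigma_pos
        gcongr
  have hlim := ((hrun.isAveragedDescent hf hC hD hμ.le).tendsto_zero hbdd).div_const (σ * (μ / 2))
  rw [zero_div] at hlim
  have hsq : Tendsto (fun k => ‖x (k + 1) - x k‖ ^ 2) atTop (𝓝 0) :=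
    squeeze_zero (fun k => by positivity) (fun k => (le_div_iff₀' hc).2 (hle k)) hlim
  simpa using hsq.sqrt

theorem mem_dom_of_mapClusterPt (hμ : 0 ≤ μ) (hlsc : LowerSemicontinuous f) {xs : E}
    (hxs : MapClusterPt xs atTop x) : xs ∈ dom f := by
  have hx := hrun.iterate_mem hf hC hD
  have hle : ∀ k, f (x k) ≤ f (x 0) := fun k => by
    rw [← coe_toReal_of_mem_dom (hf _) (hC (hx k)).1, ← coe_toReal_of_mem_dom (hf _) (hC (hx 0)).1,
      EReal.coe_le_coe_iff]
    exact (hrun.isAveragedDescent hf hC hD hμ).le_zero k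
  have hlim : f xs ≤ f (x 0) :=
    (hlsc.isClosed_preimage _).mem_of_mapClusterPt hxs (Eventually.of_forall hle)
  exact lt_of_le_of_lt (b := f (x 0)) hlim (hC (hx 0)).1

theorem inner_add_mul_lineDeriv_eq_zero (hopen : IsOpen C) (k : ℕ) (v : E) :
    ⟪grad f (x k), v⟫_ℝ +
      β ^ idx k * lineDeriv ℝ (fun w => (D k w (x k)).toReal) (x (k + 1)) v = 0 := by
  have hx := hrun.iterate_mem hf hC hD
  have hmin := (hrun.isMinOn_trial hf hC hD (le_refl (idx k))).isLocalMin
    (hopen.mem_nhds (hrun.trial_mem_of_le hf hC hD le_rfl))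
  rw [← hrun.step k] at hmin
  have hdist := ((hD k).lineDifferentiableAt _ (hx (k + 1)) _ (hx k) v).hasLineDerivAt
  have hlinear : HasLineDerivAt ℝ (fun w => ⟪grad f (x k), w - x k⟫_ℝ) ⟪grad f (x k), v⟫_ℝ
      (x (k + 1)) v := by
    have h := ((innerSL ℝ (grad f (x k))).hasFDerivAt.comp (x (k + 1))
      ((hasFDerivAt_id (x (k + 1))).sub_const (x k))).hasLineDerivAt v
    simpa [Function.comp_def] using h
  exact hmin.hasLineDerivAt_eq_zero
    (HasDerivAt.add hlinear (HasDerivAt.const_mul (β ^ idx k) hdist))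

theorem inner_grad_sub_nonneg (hopen : IsOpen C)
    (hstep : Tendsto (fun k => ‖x (k + 1) - x k‖) atTop (𝓝 0)) {xs : E}
    (hxs : MapClusterPt xs atTop x) (hgrad : ContinuousAt (grad f) xs)
    (hslope : HasAsymptoticallyNonposSlopes A C D xs) {ρ B : ℝ} (hρ : 0 < ρ) (hB : 0 < B)
    (hidx : ∀ k, x k ∈ Metric.ball xs ρ → β ^ idx k ≤ B) {z : E} (hz : z ∈ A) :
    0 ≤ ⟪grad f xs, z - xs⟫_ℝ := by
  have hx := hrun.iterate_mem hf hC hD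
  obtain ⟨ψ, hψ, hlim⟩ := hxs.tendsto_subseq
  have hlim' : Tendsto (fun j => x (ψ j + 1)) atTop (𝓝 xs) := by
    have hdiff : Tendsto (fun j => x (ψ j + 1) - x (ψ j)) atTop (𝓝 0) :=
      tendsto_zero_iff_norm_tendsto_zero.2 (hstep.comp hψ.tendsto_atTop)
    simpa using hdiff.add hlim
  have hpair : Tendsto (fun j => (x (ψ j + 1), x (ψ j))) atTop (𝓝[C ×ˢ C] (xs, xs)) :=
    tendsto_nhdsWithin_iff.2 ⟨hlim'.prodMk_nhds hlim, Eventually.of_forall fun j => ⟨hx _, hx _⟩⟩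
  have hinner : Tendsto (fun j => ⟪grad f (x (ψ j)), z - x (ψ j + 1)⟫_ℝ) atTop
      (𝓝 ⟪grad f xs, z - xs⟫_ℝ) := (hgrad.tendsto.comp hlim).inner (hlim'.const_sub z)
  refine le_of_forall_pos_le_add fun δ hδ => ?_
  rw [← neg_le_iff_add_nonneg]
  refine ge_of_tendsto hinner ?_
  filter_upwards [hpair.eventually (hslope z hz (δ / B) (div_pos hδ hB)),
    hlim (Metric.ball_mem_nhds xs hρ)] with j hj hball
  have hopt := hrun.inner_add_mul_lineDeriv_eq_zero hf hC hD hopen (ψ j) (z - x (ψ j + 1))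
  have hmul : β ^ idx (ψ j) * lineDeriv ℝ (fun w => (D (ψ j) w (x (ψ j))).toReal)
      (x (ψ j + 1)) (z - x (ψ j + 1)) ≤ δ :=
    calc _ ≤ β ^ idx (ψ j) * (δ / B) :=
          mul_le_mul_of_nonneg_left (hj (ψ j)) (hrun.pow_beta_pos _).le
      _ ≤ B * (δ / B) := mul_le_mul_of_nonneg_right (hidx _ hball) (div_pos hδ hB).le
      _ = δ := mul_div_cancel₀ δ hB.ne'
  linarith

end IsRun

end Run

/-! ### The determinant distance on the positive definite cone -/

section SymMat

variable {n : ℕ}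

theorem continuous_toMatrix : Continuous (SymMat.toMatrix : SymMat n → _) := by
  unfold SymMat.toMatrix
  exact continuous_matrix fun i j => by
    simp only [Matrix.of_apply]
    fun_prop

theorem isClosed_psdCone : IsClosed (psdCone n) := by
  have hinter : psdCone n = ⋂ v : Fin n → ℝ, {X | 0 ≤ star v ⬝ᵥ (X.toMatrix.mulVec v)} := by
    ext X
    simp only [mem_iInter, mem_ofPred_eq]
    exact ⟨fun hX v => Matrix.PosSemidef.dotProduct_mulVec_nonneg hX v,
      fun h => Matrix.PosSemidef.of_dotProduct_mulVec_nonneg X.isHermitian h⟩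
  rw [hinter]
  exact isClosed_iInter fun v => isClosed_le continuous_const
    (continuous_const.dotProduct (continuous_toMatrix.matrix_mulVec continuous_const))

theorem isOpen_pdCone : IsOpen (pdCone n) :=
  interior_psdCone n ▸ isOpen_interior

theorem pdCone_subset_psdCone : pdCone n ⊆ psdCone n :=
  interior_psdCone n ▸ interior_subset

variable {r γ₁ γ₂ μ : ℝ} {X T : SymMat n}

/-- The finite branch of the distance `pdDist`, as a real number. -/
noncomputable def pdDistReal (r γ₁ γ₂ : ℝ) (X Y : SymMat n) : ℝ :=
  γ₁ * Y.toMatrix.det ^ r *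
      (-Real.log (X.toMatrix.det / Y.toMatrix.det) + (X.toMatrix * Y.toMatrix⁻¹).trace - n)
    + γ₂ / 2 * ‖X - Y‖ ^ 2

theorem pdDist_of_mem (hT : T ∈ pdCone n) :
    pdDist r γ₁ γ₂ T X = (pdDistReal r γ₁ γ₂ T X : EReal) :=
  if_pos hT

theorem pdDist_of_notMem (hT : T ∉ pdCone n) : pdDist r γ₁ γ₂ T X = ⊤ :=
  if_neg hT

theorem pdDistReal_self (hX : X ∈ pdCone n) : pdDistReal r γ₁ γ₂ X X = 0 := by
  have hdet : X.toMatrix.det ≠ 0 := (Matrix.PosDef.det_pos hX).ne'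
  simp [pdDistReal, hdet, Matrix.mul_nonsing_inv _ hdet.isUnit]

theorem sq_norm_sub_le_pdDistReal (hγ₁ : 0 ≤ γ₁) (hT : T ∈ pdCone n) (hX : X ∈ pdCone n) :
    γ₂ / 2 * ‖T - X‖ ^ 2 ≤ pdDistReal r γ₁ γ₂ T X := by
  have hlog := log_det_div_det_le_trace_mul_inv_sub_card hT hX
  rw [Fintype.card_fin] at hlog
  have hcoeff : 0 ≤ γ₁ * X.toMatrix.det ^ r :=
    mul_nonneg hγ₁ (Real.rpow_nonneg (Matrix.PosDef.det_pos hX).le r)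
  exact le_add_of_nonneg_left (mul_nonneg hcoeff (by linarith))

theorem hasLineDerivAt_pdDistReal (hT : T ∈ pdCone n) (hX : X ∈ pdCone n) (V : SymMat n) :
    HasLineDerivAt ℝ (fun W => pdDistReal r γ₁ γ₂ W X)
      (γ₁ * (X.toMatrix.det ^ r * ((V.toMatrix * X.toMatrix⁻¹).trace -
        (V.toMatrix * T.toMatrix⁻¹).trace)) + γ₂ * ⟪T - X, V⟫_ℝ) T V := by
  have hlog := hasDerivAt_log_det_add_smul_div (Matrix.PosDef.det_pos hT).ne' V.toMatrix
    (Matrix.PosDef.det_pos hX).ne'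
  have htrace : HasDerivAt (fun t : ℝ => ((T + t • V).toMatrix * X.toMatrix⁻¹).trace)
      (V.toMatrix * X.toMatrix⁻¹).trace 0 := by
    have haffine : (fun t : ℝ => ((T + t • V).toMatrix * X.toMatrix⁻¹).trace) = fun t =>
        (T.toMatrix * X.toMatrix⁻¹).trace + t * (V.toMatrix * X.toMatrix⁻¹).trace := by
      funext t
      change ((T.toMatrix + t • V.toMatrix) * X.toMatrix⁻¹).trace = _
      rw [Matrix.add_mul, Matrix.smul_mul, Matrix.trace_add, Matrix.trace_smul, smul_eq_mul]
    rw [haffine]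
    simpa using ((hasDerivAt_id (0 : ℝ)).mul_const (V.toMatrix * X.toMatrix⁻¹).trace).const_add
      (T.toMatrix * X.toMatrix⁻¹).trace
  have hnorm : HasDerivAt (fun t : ℝ => ‖T + t • V - X‖ ^ 2) (2 * ⟪T - X, V⟫_ℝ) 0 := by
    have hline : HasDerivAt (fun t : ℝ => T + t • V - X) V 0 := by
      simpa using (((hasDerivAt_id (0 : ℝ)).smul_const V).const_add T).sub_const X
    simpa using hline.norm_sq
  exact HasDerivAt.congr_deriv ((((hlog.neg.add htrace).sub_const (n : ℝ)).const_mul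
    (γ₁ * X.toMatrix.det ^ r)).add (hnorm.const_mul (γ₂ / 2))) (by ring)

theorem hasLineDerivAt_toReal_pdDist (hT : T ∈ pdCone n) (hX : X ∈ pdCone n) (V : SymMat n) :
    HasLineDerivAt ℝ (fun W => (pdDist r γ₁ γ₂ W X).toReal)
      (γ₁ * (X.toMatrix.det ^ r * ((V.toMatrix * X.toMatrix⁻¹).trace -
        (V.toMatrix * T.toMatrix⁻¹).trace)) + γ₂ * ⟪T - X, V⟫_ℝ) T V := by
  refine (hasLineDerivAt_pdDistReal hT hX V).congr_of_eventuallyEq ?_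
  filter_upwards [isOpen_pdCone.mem_nhds hT] with W hW
  rw [pdDist_of_mem hW, EReal.toReal_coe]

theorem isProximalDistance_pdDist (hγ₁ : 0 ≤ γ₁) (hγ₂ : μ ≤ γ₂) :
    IsProximalDistance (pdCone n) μ (pdDist r γ₁ γ₂) where
  eq_top _ hT _ _ := pdDist_of_notMem hT
  ne_top _ hT _ _ := pdDist_of_mem hT ▸ EReal.coe_ne_top _
  self_eq_zero X hX := by rw [pdDist_of_mem hX, pdDistReal_self hX, EReal.coe_zero]
  sq_norm_le T hT X hX := by
    rw [pdDist_of_mem hT, EReal.coe_le_coe_iff]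
    refine le_trans ?_ (sq_norm_sub_le_pdDistReal hγ₁ hT hX)
    gcongr
  lineDifferentiableAt _ hT _ hX V := (hasLineDerivAt_toReal_pdDist hT hX V).lineDifferentiableAt

theorem hasAsymptoticallyNonposSlopes_pdDist {ι : Type*} {γmax : ℝ} {γ₁ γ₂ : ι → ℝ} (hr : 1 < r)
    (hγmax : 0 < γmax) (hγ₁ : ∀ k, γ₁ k ∈ Icc 0 γmax) (hγ₂ : ∀ k, γ₂ k ∈ Icc 0 γmax)
    (Xs : SymMat n) :
    HasAsymptoticallyNonposSlopes (psdCone n) (pdCone n) (fun k => pdDist r (γ₁ k) (γ₂ k)) Xs := by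
  intro Z hZ ε hε
  have hδ : 0 < ε / (2 * γmax) := by positivity
  have hmul_le : ∀ γ ∈ Icc 0 γmax, ∀ s < ε / (2 * γmax), γ * s ≤ ε / 2 := fun γ hγ s hs =>
    calc γ * s ≤ γ * (ε / (2 * γmax)) := mul_le_mul_of_nonneg_left hs.le hγ.1
      _ ≤ γmax * (ε / (2 * γmax)) := mul_le_mul_of_nonneg_right hγ.2 hδ.le
      _ = ε / 2 := by field_simp
  have hfst : Tendsto Prod.fst (𝓝[pdCone n ×ˢ pdCone n] (Xs, Xs)) (𝓝 Xs) :=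
    (continuous_fst.tendsto (Xs, Xs)).mono_left nhdsWithin_le_nhds
  have hsnd : Tendsto Prod.snd (𝓝[pdCone n ×ˢ pdCone n] (Xs, Xs)) (𝓝 Xs) :=
    (continuous_snd.tendsto (Xs, Xs)).mono_left nhdsWithin_le_nhds
  have hpd : ∀ᶠ q in 𝓝[pdCone n ×ˢ pdCone n] (Xs, Xs), q ∈ pdCone n ×ˢ pdCone n :=
    self_mem_nhdsWithin
  have hinner : Tendsto (fun q : SymMat n × SymMat n => ⟪q.1 - q.2, Z - q.1⟫_ℝ)
      (𝓝[pdCone n ×ˢ pdCone n] (Xs, Xs)) (𝓝 0) := by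
    simpa using (hfst.sub hsnd).inner (𝕜 := ℝ) (hfst.const_sub Z)
  have htrace := eventually_det_rpow_mul_trace_sub_lt hr
    ((continuous_toMatrix.tendsto Xs).comp hsnd) ((continuous_toMatrix.tendsto Xs).comp hfst)
    (hpd.mono fun q hq => hq.2) (hpd.mono fun q hq => hq.1) hZ hδ
  filter_upwards [hpd, htrace, hinner.eventually_lt_const hδ] with q hq hqtrace hqinner k
  rw [(hasLineDerivAt_toReal_pdDist hq.1 hq.2 (Z - q.1)).lineDeriv]
  exact (add_le_add (hmul_le _ (hγ₁ k) _ hqtrace) (hmul_le _ (hγ₂ k) _ hqinner)).trans_eq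
    (add_halves ε)

end SymMat

end ProxGrad

open ProxGrad in
theorem mainTheorem5_general {E : Type*} [NormedAddCommGroup E] [InnerProductSpace ℝ E]
    [CompleteSpace E] {f : E → EReal} {A C : Set E} {μ : ℝ} {D : ℕ → E → E → EReal} {x : ℕ → E}
    {xs : E} (hA : IsClosed A) (hC : IsOpen C) (hCA : C ⊆ A) (hμ : 0 < μ)
    (hD : ∀ k, IsProximalDistance C μ (D k)) (hf_ne_bot : ∀ z, f z ≠ ⊥)
    (hf_diff : DifferentiableOn ℝ (fun z => (f z).toReal) (interior (dom f)))
    (hf_bdd : ∃ m : ℝ, ∀ z ∈ C, (m : EReal) ≤ f z) (hf_lsc : LowerSemicontinuous f)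
    (h_C : C ⊆ dom f) (h_dom : dom f ∩ A ⊆ interior (dom f))
    (hf_lip : LocallyLipschitzOn (interior (dom f)) (grad f))
    (hx : IsGeneratedSequence f (indicatorFn A) C D x) (hxs : MapClusterPt xs atTop x)
    (hslope : HasAsymptoticallyNonposSlopes A C D xs) :
    IsFStationary (fun z => f z + indicatorFn A z) xs := by
  obtain ⟨β, σ, p, wt, Fref, trial, idx, hrun⟩ := hx
  obtain ⟨m, hm⟩ := hf_bdd
  have hCdom : C ⊆ dom f ∩ A := subset_inter h_C hCA
  have hxC := hrun.iterate_mem hf_ne_bot hCdom hD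
  have hxsA : xs ∈ A := hA.mem_of_mapClusterPt hxs (Eventually.of_forall fun k => hCA (hxC k))
  have hxs_int : xs ∈ interior (dom f) :=
    h_dom ⟨hrun.mem_dom_of_mapClusterPt hf_ne_bot hCdom hD hμ.le hf_lsc hxs, hxsA⟩
  have hxs_nhds := isOpen_interior.mem_nhds hxs_int
  have hbdd : BddBelow (range fun k => (f (x k)).toReal) := ⟨m, forall_mem_range.2 fun k => by
    rw [← EReal.coe_le_coe_iff, coe_toReal_of_mem_dom (hf_ne_bot _) (h_C (hxC k))]
    exact hm _ (hxC k)⟩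
  obtain ⟨ρ, hρ, B, hB, hidx⟩ :=
    hrun.exists_ball_pow_idx_le hf_ne_bot hCdom hD hμ hf_diff hf_lip hxs_int
  exact isFStationary_add_indicatorFn hf_ne_bot hxs_int (hf_diff.differentiableAt hxs_nhds) hxsA
    fun z hz => hrun.inner_grad_sub_nonneg hf_ne_bot hCdom hD hC
      (hrun.tendsto_norm_sub hf_ne_bot hCdom hD hμ hbdd) hxs
      (hf_lip.continuousOn.continuousAt hxs_nhds) hslope hρ hB hidx hz

theorem mainTheorem5 (n : ℕ) (r γmin γmax : ℝ) (hr : 1 < r) (hγmin : 0 < γmin)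
    (hγ : γmin ≤ γmax) (γ₁ γ₂ : ℕ → ℝ) (hγ₁ : ∀ k, γ₁ k ∈ Set.Icc γmin γmax)
    (hγ₂ : ∀ k, γ₂ k ∈ Set.Icc γmin γmax)
    (f : ProxGrad.SymMat n → EReal) (hf_ne_bot : ∀ X, f X ≠ ⊥)
    (hf_C1 : ContDiffOn ℝ 1 (fun X => (f X).toReal) (interior (ProxGrad.dom f)))
    (hf_bdd : ∃ m : ℝ, ∀ X ∈ ProxGrad.psdCone n, (m : EReal) ≤ f X)
    (hf_lsc : LowerSemicontinuous f)
    (h_pd : ProxGrad.pdCone n ⊆ interior (ProxGrad.dom f))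
    (h_dom : ProxGrad.dom f ∩ ProxGrad.psdCone n ⊆ interior (ProxGrad.dom f))
    (hf_lip : LocallyLipschitzOn (interior (ProxGrad.dom f)) (ProxGrad.grad f))
    (X : ℕ → ProxGrad.SymMat n)
    (hX : ProxGrad.IsGeneratedSequence f (ProxGrad.indicatorFn (ProxGrad.psdCone n))
      (ProxGrad.pdCone n) (fun k => ProxGrad.pdDist r (γ₁ k) (γ₂ k)) X)
    (Xs : ProxGrad.SymMat n) (hXs : MapClusterPt Xs Filter.atTop X) :
    ProxGrad.IsFStationary (fun Z => f Z + ProxGrad.indicatorFn (ProxGrad.psdCone n) Z) Xs := by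
  open ProxGrad in
  obtain ⟨m, hm⟩ := hf_bdd
  have hIcc : Icc γmin γmax ⊆ Icc 0 γmax := Icc_subset_Icc_left hγmin.le
  exact mainTheorem5_general isClosed_psdCone isOpen_pdCone pdCone_subset_psdCone hγmin
    (fun k => isProximalDistance_pdDist (hIcc (hγ₁ k)).1 (hγ₂ k).1) hf_ne_bot
    (hf_C1.differentiableOn one_ne_zero) ⟨m, fun Z hZ => hm Z (pdCone_subset_psdCone hZ)⟩ hf_lsc
    (h_pd.trans interior_subset) h_dom hf_lip hX hXs
    (hasAsymptoticallyNonposSlopes_pdDist hr (hγmin.trans_le hγ) (fun k => hIcc (hγ₁ k))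
      (fun k => hIcc (hγ₂ k)) Xs)
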